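/- Let $\mathfrak{A}$ be a $\sigma$-algebra, i.e. a Boolean algebra (with bounds $0$, $I$) in which every countable subset has a supremum. A \emph{quasipoint} of $\mathfrak{A}$ is a maximal proper dual ideal (filter) of $\mathfrak{A}$, and the \emph{Stone spectrum} $\mathcal{Q}(\mathfrak{A})$ is the set of all quasipoints with the topology generated by the sets $\mathcal{Q}_a(\mathfrak{A}) = \{\mathfrak{B} \mid a \in \mathfrak{B}\}$, $a \in \mathfrak{A}$; it is compact, and $C(\mathcal{Q}(\mathfrak{A}))$ denotes the C*-algebra of continuous functions $\mathcal{Q}(\mathfrak{A}) \to \mathbb{C}$ with pointwise operations and supremum norm. A \emph{bounded complex spectral family} in $\mathfrak{A}$ is a map $E : \mathbb{R}^2 \to \mathfrak{A}$, $(\lambda,\mu) \mapsto E_{\lambda,\mu}$, such that (i) $E_{\lambda_1,\lambda_2} \wedge E_{\mu_1,\mu_2} = E_{\min\{\lambda_1,\mu_1\},\min\{\lambda_2,\mu_2\}}$ for all real $\lambda_1, \lambda_2, \mu_1, \mu_2$; (ii) $E_{\lambda_1,\lambda_2} = \bigwedge_{\mu_1 > \lambda_1,\, \mu_2 > \lambda_2}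 E_{\mu_1,\mu_2}$ for all real $\lambda_1, \lambda_2$; (iii) $\bigwedge_{\lambda \in \mathbb{R}} E_{\lambda,\mu} = 0$ and $\bigwedge_{\lambda \in \mathbb{R}} E_{\mu,\lambda} = 0$ for all real $\mu$, and $\bigvee_{\lambda,\mu \in \mathbb{R}} E_{\lambda,\mu} = I$; (iv) there are $m, M \in \mathbb{R}$ such that $E_{\lambda,\mu} = 0$ whenever $\lambda \le m$ or $\mu \le m$, and $E_{\lambda,\mu} = I$ whenever $\lambda, \mu \ge M$. Let $\mathcal{S}_b(\mathbb{C},\mathfrak{A})$ be the set of all of them. For $E \in \mathcal{S}_b(\mathbb{C},\mathfrak{A})$ define $f_E : \mathcal{Q}(\mathfrak{A}) \to \mathbb{C}$ by $$ f_E(\mathfrak{B}) := \inf\{\lambda \in \mathbb{R} \mid \exists \mu \in \mathbb{R} : E_{\lambda,\mu} \in \mathfrak{B}\} + i \inf\{\mu \in \mathbb{R} \mid \exists \lambda \in \mathbb{R} : E_{\lambda,\mu} \in \mathfrak{B}\}. $$ Theorem. Every $f_E$ is continuous, and $E \mapsto f_E$ is a bijection of $\mathcal{S}_b(\mathbb{C},\mathfrak{A})$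 onto $C(\mathcal{Q}(\mathfrak{A}))$. Moreover $\mathcal{S}_b(\mathbb{C},\mathfrak{A})$ carries the structure of an abelian (unital) C*-algebra, with norm $\|E\| = \|f_E\|_\infty$, for which $E \mapsto f_E$ is a $*$-isomorphism onto $C(\mathcal{Q}(\mathfrak{A}))$; that is, $f_{E+F} = f_E + f_F$, $f_{EF} = f_E f_F$, $f_{\alpha E} = \alpha f_E$ for $\alpha \in \mathbb{C}$, and $f_{E^*} = \overline{f_E}$. -/

import Mathlib

universe u

/-- An abstract `σ`-algebra is a Boolean algebra in which every countable subset has a supremum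
(by complementation, every countable subset then also has an infimum). -/
class IsSigmaCompleteBooleanAlgebra (A : Type u) [BooleanAlgebra A] : Prop where
  exists_isLUB : ∀ s : Set A, s.Countable → ∃ a, IsLUB s a

/-- The Stone spectrum of a bounded lattice: the set of its quasipoints, that is, of the maximal
elements (for inclusion) among the proper dual ideals. -/
structure StoneSpectrum (A : Type u) [Lattice A] [BoundedOrder A] where
  filter : Order.PFilter A
  maximal : Maximal (fun G : Order.PFilter A => ⊥ ∉ G) filter

namespace StoneSpectrum

section Lattice

variable {A : Type u} [Lattice A] [BoundedOrder A]

instance : Membership A (StoneSpectrum A) where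
  mem B a := a ∈ B.filter

/-- The set of all quasipoints that contain a given element. -/
def basicOpen (a : A) : Set (StoneSpectrum A) := {B | a ∈ B}

/-- The topology of the Stone spectrum is generated by the sets `basicOpen a`. -/
instance : TopologicalSpace (StoneSpectrum A) :=
  TopologicalSpace.generateFrom (Set.range basicOpen)

theorem bot_notMem (B : StoneSpectrum A) : (⊥ : A) ∉ B := B.maximal.1

theorem top_mem (B : StoneSpectrum A) : (⊤ : A) ∈ B := Order.PFilter.top_mem (F := B.filter)

end Lattice

section BooleanAlgebra

variable {A : Type u} [BooleanAlgebra A]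

theorem compl_mem (B : StoneSpectrum A) {a : A} (ha : a ∉ B) : aᶜ ∈ B := by
  have hF : Order.IsPFilter {x : A | ∃ b ∈ B.filter, b ⊓ aᶜ ≤ x} := by
    refine Order.IsPFilter.of_def ⟨⊤, ⊤, Order.PFilter.top_mem, le_top⟩ ?_ ?_
    · rintro x ⟨b, hb, hbx⟩ y ⟨c, hc, hcy⟩
      refine ⟨b ⊓ c ⊓ aᶜ, ⟨b ⊓ c, Order.PFilter.inf_mem hb hc, le_rfl⟩, ?_, ?_⟩
      · exact le_trans (inf_le_inf_right _ inf_le_left) hbx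
      · exact le_trans (inf_le_inf_right _ inf_le_right) hcy
    · rintro x y hxy ⟨b, hb, hbx⟩
      exact ⟨b, hb, hbx.trans hxy⟩
  have hmem : ∀ x : A, x ∈ hF.toPFilter ↔ ∃ b ∈ B.filter, b ⊓ aᶜ ≤ x := fun x => Iff.rfl
  have hbot : (⊥ : A) ∉ hF.toPFilter := by
    rw [hmem]
    rintro ⟨b, hb, hba⟩
    apply ha
    have hle : b ≤ a := by
      rw [← sdiff_eq, le_bot_iff, sdiff_eq_bot_iff] at hba
      exact hba
    exact Order.PFilter.mem_of_le hle hb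
  have hle : B.filter ≤ hF.toPFilter := fun x hx => (hmem x).2 ⟨x, hx, inf_le_left⟩
  exact B.maximal.2 hbot hle ((hmem _).2 ⟨⊤, Order.PFilter.top_mem, inf_le_right⟩)

/-- The Stone spectrum of a Boolean algebra is compact. -/
instance : CompactSpace (StoneSpectrum A) := by
  refine ⟨isCompact_iff_ultrafilter_le_nhds.2 fun U _ => ?_⟩
  have hF : Order.IsPFilter {a : A | basicOpen a ∈ U} := by
    refine Order.IsPFilter.of_def ⟨⊤, ?_⟩ ?_ ?_
    · exact Filter.mem_of_superset Filter.univ_mem fun B _ => top_mem B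
    · intro a ha b hb
      refine ⟨a ⊓ b, ?_, inf_le_left, inf_le_right⟩
      exact Filter.mem_of_superset (Filter.inter_mem ha hb)
        fun B hB => Order.PFilter.inf_mem hB.1 hB.2
    · intro a b hab ha
      exact Filter.mem_of_superset ha fun B hB => Order.PFilter.mem_of_le hab hB
  have hmem : ∀ a : A, a ∈ hF.toPFilter ↔ basicOpen a ∈ U := fun a => Iff.rfl
  have hmax : Maximal (fun G : Order.PFilter A => ⊥ ∉ G) hF.toPFilter := by
    constructor
    · intro h
      obtain ⟨B, hB⟩ := Filter.NeBot.nonempty_of_mem U.neBot ((hmem _).1 h)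
      exact bot_notMem B hB
    · intro G hG hle a ha
      by_contra hna
      have h1 : (basicOpen a)ᶜ ∈ U := Ultrafilter.compl_mem_iff_notMem.2 hna
      have h2 : basicOpen aᶜ ∈ U := Filter.mem_of_superset h1 fun B hB => compl_mem B hB
      apply hG
      rw [← inf_compl_eq_bot (a := a)]
      exact Order.PFilter.inf_mem ha (hle ((hmem _).2 h2))
  refine ⟨⟨_, hmax⟩, Set.mem_univ _, ?_⟩
  rw [TopologicalSpace.nhds_generateFrom (g := Set.range (basicOpen (A := A)))]
  refine le_iInf₂ fun s hs => ?_
  obtain ⟨hs, a, rfl⟩ := hs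
  exact Filter.le_principal_iff.2 hs

end BooleanAlgebra

end StoneSpectrum

/-- A bounded complex (that is, two-parameter) spectral family in a bounded lattice `A`. All infima
and suprema in the definition are asserted to exist in `A`. -/
structure BoundedComplexSpectralFamily (A : Type u) [Lattice A] [BoundedOrder A] where
  toFun : ℝ → ℝ → A
  inf_eq : ∀ l₁ l₂ m₁ m₂ : ℝ, toFun l₁ l₂ ⊓ toFun m₁ m₂ = toFun (min l₁ m₁) (min l₂ m₂)
  isGLB_gt : ∀ l₁ l₂ : ℝ,
    IsGLB {a : A | ∃ m₁ m₂ : ℝ, l₁ < m₁ ∧ l₂ < m₂ ∧ a = toFun m₁ m₂} (toFun l₁ l₂)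
  isGLB_left : ∀ m : ℝ, IsGLB (Set.range fun l : ℝ => toFun l m) ⊥
  isGLB_right : ∀ l : ℝ, IsGLB (Set.range fun m : ℝ => toFun l m) ⊥
  isLUB_top : IsLUB {a : A | ∃ l m : ℝ, a = toFun l m} ⊤
  bounded : ∃ b c : ℝ, (∀ l m : ℝ, l ≤ b ∨ m ≤ b → toFun l m = ⊥) ∧
    ∀ l m : ℝ, c ≤ l → c ≤ m → toFun l m = ⊤

namespace BoundedComplexSpectralFamily

variable {A : Type u} [Lattice A] [BoundedOrder A]

/-- The first parameters `l` for which some `E l m` belongs to the quasipoint `B`. -/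
def reSet (E : BoundedComplexSpectralFamily A) (B : StoneSpectrum A) : Set ℝ :=
  {l : ℝ | ∃ m : ℝ, E.toFun l m ∈ B}

/-- The second parameters `m` for which some `E l m` belongs to the quasipoint `B`. -/
def imSet (E : BoundedComplexSpectralFamily A) (B : StoneSpectrum A) : Set ℝ :=
  {m : ℝ | ∃ l : ℝ, E.toFun l m ∈ B}

/-- The infimum of `reSet` is a genuine one. -/
theorem reSet_nonempty_bddBelow (E : BoundedComplexSpectralFamily A) (B : StoneSpectrum A) :
    (E.reSet B).Nonempty ∧ BddBelow (E.reSet B) := by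
  obtain ⟨b, c, hb, hc⟩ := E.bounded
  refine ⟨⟨c, c, ?_⟩, ⟨b, ?_⟩⟩
  · rw [hc c c le_rfl le_rfl]
    exact B.top_mem
  · rintro l ⟨m, hm⟩
    by_contra hlt
    rw [hb l m (Or.inl (not_le.1 hlt).le)] at hm
    exact B.bot_notMem hm

/-- The infimum of `imSet` is a genuine one. -/
theorem imSet_nonempty_bddBelow (E : BoundedComplexSpectralFamily A) (B : StoneSpectrum A) :
    (E.imSet B).Nonempty ∧ BddBelow (E.imSet B) := by
  obtain ⟨b, c, hb, hc⟩ := E.bounded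
  refine ⟨⟨c, c, ?_⟩, ⟨b, ?_⟩⟩
  · rw [hc c c le_rfl le_rfl]
    exact B.top_mem
  · rintro m ⟨l, hl⟩
    by_contra hlt
    rw [hb l m (Or.inr (not_le.1 hlt).le)] at hl
    exact B.bot_notMem hl

/-- The function `f_E = f_{E,1} + i f_{E,2}` on the Stone spectrum associated to `E`. -/
noncomputable def assocFun (E : BoundedComplexSpectralFamily A) (B : StoneSpectrum A) : ℂ :=
  ((sInf (E.reSet B) : ℝ) : ℂ) + Complex.I * ((sInf (E.imSet B) : ℝ) : ℂ)

end BoundedComplexSpectralFamily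

/-! The value `E.toFun l m` is recoverable from `f_E`: it is the greatest `a` whose basic set lies
in the sublevel set where `Re f_E ≤ l` and `Im f_E ≤ m` (`isGreatest_toFun`), which gives
injectivity. For surjectivity, take these greatest elements for a given continuous `g` as the
definition. They exist because the sublevel sets are closed `Gδ`: compactness squeezes a basic set
between the closed set and each of its open neighbourhoods, and σ-completeness supplies the infimum
of the countably many elements obtained (`exists_isGreatest_basicOpen_subset`). The C⋆-structure is
then pulled back along the bijection. -/

namespace StoneSpectrum

/-! ### Quasipoints, basic sets and closed `Gδ` sets -/

section BooleanAlgebra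

variable {A : Type u} [BooleanAlgebra A]

theorem mem_of_le (B : StoneSpectrum A) {a b : A} (hab : a ≤ b) (ha : a ∈ B) : b ∈ B :=
  Order.PFilter.mem_of_le hab ha

theorem inf_mem (B : StoneSpectrum A) {a b : A} (ha : a ∈ B) (hb : b ∈ B) : a ⊓ b ∈ B :=
  Order.PFilter.inf_mem ha hb

theorem compl_mem_iff (B : StoneSpectrum A) {a : A} : aᶜ ∈ B ↔ a ∉ B := by
  refine ⟨fun h ha => B.bot_notMem ?_, B.compl_mem⟩
  rw [← inf_compl_eq_bot (a := a)]
  exact B.inf_mem ha h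

theorem sup_mem_iff (B : StoneSpectrum A) {a b : A} : a ⊔ b ∈ B ↔ a ∈ B ∨ b ∈ B := by
  refine ⟨fun h => ?_, fun h => h.elim (B.mem_of_le le_sup_left) (B.mem_of_le le_sup_right)⟩
  by_contra! hn
  have h1 := B.inf_mem (B.compl_mem hn.1) (B.compl_mem hn.2)
  rw [← compl_sup, compl_mem_iff] at h1
  exact h1 h

/-- Quasipoints separate the elements of a Boolean algebra. -/
theorem exists_mem_notMem {a b : A} (hab : ¬ a ≤ b) : ∃ B : StoneSpectrum A, a ∈ B ∧ b ∉ B := by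
  have hdisj : Disjoint (Order.PFilter.principal a : Set A) (Order.Ideal.principal b : Set A) := by
    refine Set.disjoint_left.2 fun x hx hx' => hab ?_
    exact (Order.PFilter.mem_principal.1 hx).trans (Order.Ideal.mem_principal.1 hx')
  -- The complement of a prime ideal containing `b` but not `a` is the required quasipoint.
  obtain ⟨J, hJ, hbJ, haJ⟩ := DistribLattice.prime_ideal_of_disjoint_filter_ideal hdisj
  have hF := hJ.compl_filter
  have hmem : ∀ x : A, x ∈ hF.toPFilter ↔ x ∉ J := fun x => Iff.rfl
  have hmax : Maximal (fun G : Order.PFilter A => ⊥ ∉ G) hF.toPFilter := by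
    refine ⟨fun h => (hmem _).1 h J.bot_mem, fun G hG hle x hx => (hmem x).2 fun hxJ => hG ?_⟩
    rw [← inf_compl_eq_bot (a := x)]
    refine Order.PFilter.inf_mem hx (hle ((hmem _).2 fun hx' => ?_))
    exact hJ.toIsProper.notMem_of_compl_mem hx' (by simpa using hxJ)
  refine ⟨⟨_, hmax⟩, (hmem a).2 fun h => ?_, fun h => (hmem b).1 h (hbJ (by simp))⟩
  exact Set.disjoint_left.1 haJ (Order.PFilter.mem_principal.2 le_rfl) h

theorem basicOpen_subset_iff {a b : A} : basicOpen a ⊆ basicOpen b ↔ a ≤ b := by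
  refine ⟨fun h => ?_, fun h B hB => B.mem_of_le h hB⟩
  by_contra hab
  obtain ⟨B, ha, hb⟩ := exists_mem_notMem hab
  exact hb (h ha)

theorem isOpen_basicOpen (a : A) : IsOpen (basicOpen a) :=
  TopologicalSpace.isOpen_generateFrom_of_mem ⟨a, rfl⟩

theorem isTopologicalBasis_basicOpen :
    TopologicalSpace.IsTopologicalBasis (Set.range (basicOpen (A := A))) where
  exists_subset_inter := by
    rintro _ ⟨a, rfl⟩ _ ⟨b, rfl⟩ B ⟨ha, hb⟩
    exact ⟨_, ⟨a ⊓ b, rfl⟩, B.inf_mem ha hb, fun C hC =>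
      ⟨C.mem_of_le inf_le_left hC, C.mem_of_le inf_le_right hC⟩⟩
  sUnion_eq := Set.eq_univ_of_forall fun B => ⟨_, ⟨⊤, rfl⟩, B.top_mem⟩
  eq_generateFrom := rfl

theorem exists_mem_basicOpen_subset {U : Set (StoneSpectrum A)} (hU : IsOpen U)
    {B : StoneSpectrum A} (hB : B ∈ U) : ∃ a ∈ B, basicOpen a ⊆ U := by
  obtain ⟨_, ⟨a, rfl⟩, ha, haU⟩ := isTopologicalBasis_basicOpen.exists_subset_of_mem_open hB hU
  exact ⟨a, ha, haU⟩

/-- A closed set and an open set containing it can be separated by a basic set. -/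
theorem exists_subset_basicOpen_subset {K U : Set (StoneSpectrum A)} (hK : IsClosed K)
    (hU : IsOpen U) (hKU : K ⊆ U) : ∃ a : A, K ⊆ basicOpen a ∧ basicOpen a ⊆ U := by
  -- Finite unions are harmless, since joins of elements correspond to unions of basic sets.
  refine hK.isCompact.induction_on (p := fun s => ∃ a : A, s ⊆ basicOpen a ∧ basicOpen a ⊆ U)
    ⟨⊥, Set.empty_subset _, fun B hB => (B.bot_notMem hB).elim⟩ ?_ ?_ ?_
  · rintro s t hst ⟨a, ha, haU⟩
    exact ⟨a, hst.trans ha, haU⟩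
  · rintro s t ⟨a, ha, haU⟩ ⟨b, hb, hbU⟩
    refine ⟨a ⊔ b, ?_, fun B hB => (B.sup_mem_iff.1 hB).elim (@haU B) (@hbU B)⟩
    exact Set.union_subset (fun B hB => B.sup_mem_iff.2 (Or.inl (ha hB)))
      (fun B hB => B.sup_mem_iff.2 (Or.inr (hb hB)))
  · intro B hB
    obtain ⟨a, ha, haU⟩ := exists_mem_basicOpen_subset hU (hKU hB)
    exact ⟨basicOpen a, mem_nhdsWithin_of_mem_nhds ((isOpen_basicOpen a).mem_nhds ha),
      a, Set.Subset.rfl, haU⟩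

theorem exists_isGLB_of_countable [IsSigmaCompleteBooleanAlgebra A] {s : Set A}
    (hs : s.Countable) : ∃ a, IsGLB s a := by
  obtain ⟨a, ha⟩ := IsSigmaCompleteBooleanAlgebra.exists_isLUB _ (hs.image compl)
  refine ⟨aᶜ, fun x hx => compl_le_of_compl_le (ha.1 ⟨x, hx, rfl⟩), fun b hb => ?_⟩
  refine le_compl_of_le_compl (ha.2 ?_)
  rintro _ ⟨x, hx, rfl⟩
  exact compl_le_compl (hb hx)

/-- In the Stone spectrum of a `σ`-algebra, a closed `Gδ` set contains a largest basic set. -/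
theorem exists_isGreatest_basicOpen_subset [IsSigmaCompleteBooleanAlgebra A]
    {K : Set (StoneSpectrum A)} (hK : IsClosed K) {U : ℕ → Set (StoneSpectrum A)}
    (hU : ∀ n, IsOpen (U n)) (hKU : K = ⋂ n, U n) :
    ∃ a : A, IsGreatest {a : A | basicOpen a ⊆ K} a := by
  choose a haK haU using fun n =>
    exists_subset_basicOpen_subset hK (hU n) (hKU.subset.trans (Set.iInter_subset U n))
  obtain ⟨b, hb⟩ := exists_isGLB_of_countable (Set.countable_range a)
  refine ⟨b, ?_, fun c hc => hb.2 ?_⟩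
  · rw [Set.mem_ofPred_eq, hKU]
    exact Set.subset_iInter fun n => (basicOpen_subset_iff.2 (hb.1 ⟨n, rfl⟩)).trans (haU n)
  · rintro _ ⟨n, rfl⟩
    -- Each `a n` was chosen with its basic set covering `K`, so it dominates every `c` whose basic
    -- set lies in `K`.
    exact basicOpen_subset_iff.1 (Set.Subset.trans hc (haK n))

end BooleanAlgebra

end StoneSpectrum

/-! ### Transport of C⋆-structure -/

/-- The structure of a commutative C⋆-algebra transported along a bijection. -/
noncomputable abbrev Equiv.commCStarAlgebra {S R : Type*} [CommCStarAlgebra R] (e : S ≃ R) :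
    CommCStarAlgebra S :=
  letI : CommRing S := e.commRing
  letI : Algebra ℂ S := e.algebra ℂ
  letI φ : S ≃ₐ[ℂ] R := e.algEquiv ℂ
  letI : NormedCommRing S := NormedCommRing.induced S R φ φ.injective
  letI : NormedAlgebra ℂ S := NormedAlgebra.induced ℂ S R φ
  letI : StarRing S :=
    { star := fun x => φ.symm (star (φ x))
      star_involutive := fun x => by simp
      star_mul := fun x y => by simp [mul_comm]
      star_add := fun x y => by simp }
  { norm_mul_self_le := fun {x} => by
      change ‖φ x‖ * ‖φ x‖ ≤ ‖φ (φ.symm (star (φ x)) * x)‖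
      rw [map_mul, AlgEquiv.apply_symm_apply]
      exact CStarRing.norm_mul_self_le (φ x)
    complete := fun {_} => by
      have h : Isometry φ := AddMonoidHomClass.isometry_of_norm φ fun _ => rfl
      have hS : CompleteSpace S :=
        (h.isUniformInducing.completeSpace_congr φ.surjective).2 inferInstance
      exact hS.complete
    star_smul := fun r x => by
      change φ.symm (star (φ (r • x))) = star r • φ.symm (star (φ x))
      rw [map_smul, star_smul, map_smul] }

/-- The `⋆`-isomorphism underlying `Equiv.commCStarAlgebra`. -/
noncomputable def Equiv.commCStarAlgebraStarAlgEquiv {S R : Type*} [CommCStarAlgebra R]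
    (e : S ≃ R) : letI := e.commCStarAlgebra; S ≃⋆ₐ[ℂ] R :=
  letI := e.commCStarAlgebra
  { e with
    map_add' := fun _ _ => e.apply_symm_apply _
    map_mul' := fun _ _ => e.apply_symm_apply _
    map_smul' := fun _ _ => e.apply_symm_apply _
    map_star' := fun _ => e.apply_symm_apply _ }

/-! ### Continuity and injectivity -/

namespace BoundedComplexSpectralFamily

section Lattice

variable {A : Type u} [Lattice A] [BoundedOrder A]

@[ext]
theorem ext {E F : BoundedComplexSpectralFamily A} (h : ∀ l m, E.toFun l m = F.toFun l m) :
    E = F := by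
  cases E
  cases F
  congr
  exact funext₂ h

theorem mono (E : BoundedComplexSpectralFamily A) {l l' m m' : ℝ} (hl : l ≤ l') (hm : m ≤ m') :
    E.toFun l m ≤ E.toFun l' m' := by
  rw [← inf_eq_left, E.inf_eq, min_eq_left hl, min_eq_left hm]

theorem assocFun_re (E : BoundedComplexSpectralFamily A) (B : StoneSpectrum A) :
    (E.assocFun B).re = sInf (E.reSet B) := by
  simp [assocFun]

theorem assocFun_im (E : BoundedComplexSpectralFamily A) (B : StoneSpectrum A) :
    (E.assocFun B).im = sInf (E.imSet B) := by
  simp [assocFun]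

theorem re_assocFun_le (E : BoundedComplexSpectralFamily A) {B : StoneSpectrum A} {l m : ℝ}
    (h : E.toFun l m ∈ B) : (E.assocFun B).re ≤ l := by
  rw [assocFun_re]
  exact csInf_le (E.reSet_nonempty_bddBelow B).2 ⟨m, h⟩

theorem im_assocFun_le (E : BoundedComplexSpectralFamily A) {B : StoneSpectrum A} {l m : ℝ}
    (h : E.toFun l m ∈ B) : (E.assocFun B).im ≤ m := by
  rw [assocFun_im]
  exact csInf_le (E.imSet_nonempty_bddBelow B).2 ⟨l, h⟩

end Lattice

variable {A : Type u} [BooleanAlgebra A]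

/-- The two infima are witnessed by unrelated members of the family; their meet lies in the
quasipoint and is again a member, which controls both parameters at once. -/
theorem mem_of_assocFun_lt (E : BoundedComplexSpectralFamily A) {B : StoneSpectrum A} {l m : ℝ}
    (hl : (E.assocFun B).re < l) (hm : (E.assocFun B).im < m) : E.toFun l m ∈ B := by
  rw [assocFun_re] at hl
  rw [assocFun_im] at hm
  obtain ⟨l', ⟨m₁, h₁⟩, hl'⟩ := exists_lt_of_csInf_lt (E.reSet_nonempty_bddBelow B).1 hl
  obtain ⟨m', ⟨l₁, h₂⟩, hm'⟩ := exists_lt_of_csInf_lt (E.imSet_nonempty_bddBelow B).1 hm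
  have h := B.inf_mem h₁ h₂
  rw [E.inf_eq] at h
  exact B.mem_of_le (E.mono ((min_le_left _ _).trans hl'.le) ((min_le_right _ _).trans hm'.le)) h

theorem exists_assocFun_lt (E : BoundedComplexSpectralFamily A) :
    ∃ c : ℝ, ∀ B, (E.assocFun B).re < c ∧ (E.assocFun B).im < c := by
  obtain ⟨-, c, -, hc⟩ := E.bounded
  refine ⟨c + 1, fun B => ?_⟩
  have h : E.toFun c c ∈ B := by
    rw [hc c c le_rfl le_rfl]
    exact B.top_mem
  exact ⟨(E.re_assocFun_le h).trans_lt (lt_add_one c), (E.im_assocFun_le h).trans_lt (lt_add_one c)⟩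

/-- Basic sets are clopen: `a s` bounds `f` above by `s` near a point, and its complement bounds `f`
below by `s`. -/
theorem continuous_of_forall_mem_basicOpen {f : StoneSpectrum A → ℝ} (a : ℝ → A)
    (h₁ : ∀ B l, f B < l → a l ∈ B) (h₂ : ∀ B l, a l ∈ B → f B ≤ l) : Continuous f := by
  refine continuous_iff_continuousAt.2 fun B => tendsto_order.2 ⟨fun t ht => ?_, fun t ht => ?_⟩
  · obtain ⟨s, hts, hs⟩ := exists_between ht
    have hB : B ∈ StoneSpectrum.basicOpen (a s)ᶜ :=
      B.compl_mem fun h => (h₂ B s h).not_gt hs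
    filter_upwards [(StoneSpectrum.isOpen_basicOpen _).mem_nhds hB] with C hC
    by_contra! hle
    exact C.compl_mem_iff.1 hC (h₁ C s (hle.trans_lt hts))
  · obtain ⟨s, hs, hst⟩ := exists_between ht
    filter_upwards [(StoneSpectrum.isOpen_basicOpen _).mem_nhds (h₁ B s hs)] with C hC
    exact (h₂ C s hC).trans_lt hst

theorem continuous_assocFun (E : BoundedComplexSpectralFamily A) : Continuous E.assocFun := by
  obtain ⟨c, hc⟩ := E.exists_assocFun_lt
  -- Freezing the other parameter at `c`, strictly above all values, leaves a one-parameter family.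
  have hre : Continuous fun B => (E.assocFun B).re :=
    continuous_of_forall_mem_basicOpen (fun l => E.toFun l c)
      (fun B _ h => E.mem_of_assocFun_lt h (hc B).2) fun _ _ => E.re_assocFun_le
  have him : Continuous fun B => (E.assocFun B).im :=
    continuous_of_forall_mem_basicOpen (fun m => E.toFun c m)
      (fun B _ h => E.mem_of_assocFun_lt (hc B).1 h) fun _ _ => E.im_assocFun_le
  exact Complex.equivRealProdCLM.symm.continuous.comp (hre.prodMk him)

/-- A spectral family is determined by its associated function. -/
theorem isGreatest_toFun (E : BoundedComplexSpectralFamily A) (l m : ℝ) :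
    IsGreatest {a : A | StoneSpectrum.basicOpen a ⊆
      {B | (E.assocFun B).re ≤ l ∧ (E.assocFun B).im ≤ m}} (E.toFun l m) := by
  refine ⟨fun B hB => ⟨E.re_assocFun_le hB, E.im_assocFun_le hB⟩, fun a ha => ?_⟩
  refine (E.isGLB_gt l m).2 ?_
  rintro _ ⟨l', m', hl, hm, rfl⟩
  refine StoneSpectrum.basicOpen_subset_iff.1 fun B hB => ?_
  exact E.mem_of_assocFun_lt ((ha hB).1.trans_lt hl) ((ha hB).2.trans_lt hm)

theorem assocFun_injective :
    Function.Injective (assocFun : BoundedComplexSpectralFamily A → StoneSpectrum A → ℂ) := by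
  intro E F h
  ext l m
  have hE := E.isGreatest_toFun l m
  rw [h] at hE
  exact hE.unique (F.isGreatest_toFun l m)

/-! ### Surjectivity over a σ-algebra -/

section Sigma

variable [IsSigmaCompleteBooleanAlgebra A]

theorem exists_isGreatest_basicOpen_subset_re_im_le (g : C(StoneSpectrum A, ℂ)) (l m : ℝ) :
    ∃ a : A, IsGreatest {a : A | StoneSpectrum.basicOpen a ⊆
      {B | (g B).re ≤ l ∧ (g B).im ≤ m}} a := by
  have hre : Continuous fun B => (g B).re := Complex.continuous_re.comp g.continuous
  have him : Continuous fun B => (g B).im := Complex.continuous_im.comp g.continuous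
  refine StoneSpectrum.exists_isGreatest_basicOpen_subset
    (U := fun n : ℕ => {B | (g B).re < l + 1 / (n + 1) ∧ (g B).im < m + 1 / (n + 1)})
    ((isClosed_le hre continuous_const).inter (isClosed_le him continuous_const))
    (fun n => (isOpen_lt hre continuous_const).inter (isOpen_lt him continuous_const)) ?_
  ext B
  simp only [Set.mem_ofPred_eq, Set.mem_iInter]
  refine ⟨fun h n => ?_, fun h => ?_⟩
  · have hn : (0 : ℝ) < 1 / (n + 1) := Nat.one_div_pos_of_nat
    exact ⟨h.1.trans_lt (lt_add_of_pos_right _ hn), h.2.trans_lt (lt_add_of_pos_right _ hn)⟩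
  · constructor <;> refine le_of_forall_pos_lt_add fun ε hε => ?_ <;>
      obtain ⟨n, hn⟩ := exists_nat_one_div_lt hε
    · linarith [(h n).1]
    · linarith [(h n).2]

theorem exists_assocFun_eq (g : C(StoneSpectrum A, ℂ)) :
    ∃ E : BoundedComplexSpectralFamily A, E.assocFun = g := by
  choose e he using exists_isGreatest_basicOpen_subset_re_im_le g
  -- This reduces inequalities `a ≤ e l m` to real inequalities at each quasipoint.
  have hle : ∀ l m a, a ≤ e l m ↔ ∀ B : StoneSpectrum A, a ∈ B → (g B).re ≤ l ∧ (g B).im ≤ m :=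
    fun l m a => ⟨fun h B hB => (he l m).1 (B.mem_of_le h hB), fun h => (he l m).2 h⟩
  have hbd : ∀ B, |(g B).re| ≤ ‖g‖ ∧ |(g B).im| ≤ ‖g‖ := fun B =>
    ⟨(Complex.abs_re_le_norm _).trans (g.norm_coe_le_norm B),
      (Complex.abs_im_le_norm _).trans (g.norm_coe_le_norm B)⟩
  -- The extra `-1` is needed because `g` may attain `-‖g‖` in a coordinate.
  have hbot : ∀ l m : ℝ, l ≤ -‖g‖ - 1 ∨ m ≤ -‖g‖ - 1 → e l m = ⊥ := by
    refine fun l m h => StoneSpectrum.basicOpen_subset_iff.1 (fun B hB => ?_) |> le_bot_iff.1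
    obtain ⟨h₁, h₂⟩ := (he l m).1 hB
    have h₃ := abs_le.1 (hbd B).1
    have h₄ := abs_le.1 (hbd B).2
    rcases h with h | h <;> linarith
  have htop : ∀ l m : ℝ, ‖g‖ ≤ l → ‖g‖ ≤ m → e l m = ⊤ := fun l m hl hm =>
    top_le_iff.1 <| (hle l m ⊤).2 fun B _ =>
      ⟨(le_abs_self _).trans ((hbd B).1.trans hl), (le_abs_self _).trans ((hbd B).2.trans hm)⟩
  -- The strict sublevel set is open, so it contains a basic neighbourhood of `B`, whose element is
  -- below `e l m` by greatestness.
  have hmem : ∀ (B : StoneSpectrum A) (l m : ℝ), (g B).re < l → (g B).im < m → e l m ∈ B := by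
    intro B l m hl hm
    have hU : IsOpen {B | (g B).re < l ∧ (g B).im < m} :=
      (isOpen_lt (Complex.continuous_re.comp g.continuous) continuous_const).inter
        (isOpen_lt (Complex.continuous_im.comp g.continuous) continuous_const)
    obtain ⟨a, ha, haU⟩ := StoneSpectrum.exists_mem_basicOpen_subset hU ⟨hl, hm⟩
    exact B.mem_of_le ((hle l m a).2 fun C hC => ⟨(haU hC).1.le, (haU hC).2.le⟩) ha
  let E : BoundedComplexSpectralFamily A :=
    { toFun := e
      inf_eq := fun l₁ l₂ m₁ m₂ => eq_of_forall_le_iff fun a => by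
        simp only [le_inf_iff, hle]
        grind
      isGLB_gt := fun l₁ l₂ => by
        constructor
        · rintro _ ⟨m₁, m₂, h₁, h₂, rfl⟩
          refine (hle _ _ _).2 fun B hB => ?_
          obtain ⟨h₃, h₄⟩ := (he l₁ l₂).1 hB
          exact ⟨h₃.trans h₁.le, h₄.trans h₂.le⟩
        · refine fun a ha => (hle _ _ _).2 fun B hB => ?_
          have h : ∀ ε > 0, (g B).re ≤ l₁ + ε ∧ (g B).im ≤ l₂ + ε := fun ε hε =>
            (hle _ _ _).1 (ha ⟨l₁ + ε, l₂ + ε, lt_add_of_pos_right _ hε,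
              lt_add_of_pos_right _ hε, rfl⟩) B hB
          exact ⟨le_of_forall_pos_le_add fun ε hε => (h ε hε).1,
            le_of_forall_pos_le_add fun ε hε => (h ε hε).2⟩
      isGLB_left := fun m => ⟨fun _ _ => bot_le, fun a ha =>
        (ha ⟨_, rfl⟩).trans (hbot _ m (Or.inl le_rfl)).le⟩
      isGLB_right := fun l => ⟨fun _ _ => bot_le, fun a ha =>
        (ha ⟨_, rfl⟩).trans (hbot l _ (Or.inr le_rfl)).le⟩
      isLUB_top := ⟨fun _ _ => le_top, fun a ha =>
        (htop _ _ le_rfl le_rfl).ge.trans (ha ⟨‖g‖, ‖g‖, rfl⟩)⟩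
      bounded := ⟨-‖g‖ - 1, ‖g‖, hbot, htop⟩ }
  refine ⟨E, funext fun B => Complex.ext ?_ ?_⟩
  · rw [assocFun_re]
    refine csInf_eq_of_forall_ge_of_forall_gt_exists_lt (E.reSet_nonempty_bddBelow B).1
      (fun l ⟨m, h⟩ => ((he l m).1 h).1) fun t ht => ?_
    obtain ⟨s, hs, hst⟩ := exists_between ht
    exact ⟨s, ⟨_, hmem B s _ hs (lt_add_one _)⟩, hst⟩
  · rw [assocFun_im]
    refine csInf_eq_of_forall_ge_of_forall_gt_exists_lt (E.imSet_nonempty_bddBelow B).1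
      (fun m ⟨l, h⟩ => ((he l m).1 h).2) fun t ht => ?_
    obtain ⟨s, hs, hst⟩ := exists_between ht
    exact ⟨s, ⟨_, hmem B _ s (lt_add_one _) hs⟩, hst⟩

/-- The bijection between spectral families and continuous functions on the Stone spectrum. -/
noncomputable def assocFunEquiv : BoundedComplexSpectralFamily A ≃ C(StoneSpectrum A, ℂ) :=
  Equiv.ofBijective (fun E => ⟨E.assocFun, E.continuous_assocFun⟩)
    ⟨fun _ _ h => assocFun_injective (congrArg DFunLike.coe h), fun g =>
      (exists_assocFun_eq g).imp fun _ h => ContinuousMap.ext (congrFun h)⟩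

end Sigma

end BoundedComplexSpectralFamily

theorem mainTheorem5 {A : Type u} [BooleanAlgebra A] [IsSigmaCompleteBooleanAlgebra A] :
    (∀ E : BoundedComplexSpectralFamily A, Continuous E.assocFun) ∧
    (∀ g : C(StoneSpectrum A, ℂ), ∃! E : BoundedComplexSpectralFamily A, E.assocFun = ⇑g) ∧
    ∃ (_ : CommCStarAlgebra (BoundedComplexSpectralFamily A))
      (Φ : BoundedComplexSpectralFamily A ≃⋆ₐ[ℂ] C(StoneSpectrum A, ℂ)),
      (∀ (E : BoundedComplexSpectralFamily A) (B : StoneSpectrum A), Φ E B = E.assocFun B) ∧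
      ∀ E : BoundedComplexSpectralFamily A, ‖E‖ = ‖Φ E‖ := by
  refine ⟨fun E => E.continuous_assocFun, fun g => ?_,
    BoundedComplexSpectralFamily.assocFunEquiv.commCStarAlgebra,
    BoundedComplexSpectralFamily.assocFunEquiv.commCStarAlgebraStarAlgEquiv,
    fun _ _ => rfl, fun _ => rfl⟩
  obtain ⟨E, hE⟩ := BoundedComplexSpectralFamily.exists_assocFun_eq g
  exact ⟨E, hE, fun F hF => BoundedComplexSpectralFamily.assocFun_injective (hF.trans hE.symm)⟩
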